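/- Let $h=\prod_{i=1}^{t}p_i^{s_i}>1$ with $p_1,\dots,p_t$ distinct primes and $s_i\ge 1$. A family of $k$ vectors in $\mathbb{Z}_h^n$ is unimodular if the $k\times n$ matrix with these rows has a right inverse. The dimension $\dim V$ of a $\mathbb{Z}_h$-submodule $V\subseteq\mathbb{Z}_h^n$ is the largest number of vectors in a unimodular family contained in $V$, and an $m$-subspace of $\mathbb{Z}_h^n$ is a submodule spanned by a unimodular family of $m$ vectors. The graph $G_r(m,n,\mathbb{Z}_h)$ has the $m$-subspaces of $\mathbb{Z}_h^n$ as its vertices, two distinct vertices $A,B$ being adjacent if and only if $\dim(A\cap B)>m-r$; $\alpha(\Gamma)$ denotes the maximum cardinality of an independent set of a graph $\Gamma$. Theorem 5.8. Let $n>m\ge 2$ and let $\ell$ be an integer with $0\le\ell<m$ and $n\equiv\ell\pmod m$. Suppose moreover that $n\ge 2m$ or that $h$ is squarefree (that is, all $s_i=1$). Then $$\alpha(G_m(m,n,\mathbb{Z}_h))\ \ge\ \prod_{i=1}^{t}p_i^{(s_i-1)(n-m)}\,\frac{p_i^{n}-p_i^{m}(p_i^{\ell}-1)-1}{p_i^{m}-1}.$$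 -/

import Mathlib

namespace ResidueGrassmann

/-- A finite family of vectors of `R ^ n` is unimodular if the matrix having these vectors
as its rows has a right inverse. -/
def IsUnimodular {R : Type*} [CommRing R] {k n : ℕ} (v : Fin k → (Fin n → R)) : Prop :=
  ∃ B : Matrix (Fin n) (Fin k) R, Matrix.of v * B = 1

/-- The dimension of a linear subset `V` of `R ^ n`: the number of vectors in a largest
unimodular family of vectors of `V`. -/
noncomputable def dim {R : Type*} [CommRing R] {n : ℕ} (V : Submodule R (Fin n → R)) : ℕ :=
  sSup {k : ℕ | ∃ v : Fin k → (Fin n → R), (∀ i, v i ∈ V) ∧ IsUnimodular v}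

/-- `X` is an `m`-subspace of `R ^ n`: it has a unimodular basis consisting of `m` vectors
(a unimodular family is automatically linearly independent). -/
def IsSubspace {R : Type*} [CommRing R] {n : ℕ} (m : ℕ) (X : Submodule R (Fin n → R)) : Prop :=
  ∃ v : Fin m → (Fin n → R), IsUnimodular v ∧ Submodule.span R (Set.range v) = X

/-- The generalized Grassmann graph `G_r(m, n, R)`: the vertices are the `m`-subspaces of `R ^ n`,
and two distinct vertices are adjacent if the dimension of their intersection
is larger than `m - r` (written without subtraction, because `r = m + 1` is allowed). -/
def grassmannGraph (r m n : ℕ) (R : Type*) [CommRing R] :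
    SimpleGraph {X : Submodule R (Fin n → R) // IsSubspace m X} where
  Adj X Y := X ≠ Y ∧ m < dim (X.1 ⊓ Y.1) + r
  symm := ⟨fun X Y hXY => ⟨hXY.1.symm, by rw [inf_comm]; exact hXY.2⟩⟩
  loopless := ⟨fun X hX => hX.1 rfl⟩

end ResidueGrassmann

/-! It suffices to find many free `m`-subspaces no two of which share a unimodular vector. Over the
field with `p` elements a partial spread does this (`exists_partial_spread`). When `n ≥ 2m`, passing
from `p ^ s` to `p ^ (s + 1)` splits each member into `p ^ (n - m)` perturbations that stay
separated (`IsSeparated.exists_lift`). The Chinese remainder theorem glues one choice per prime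
(`card_le_indepNum`): two different choices differ at some prime `p i`, so every common vector
vanishes modulo `p i` and is not unimodular. The sizes multiply to the stated bound. -/

namespace ResidueGrassmann

open Matrix

/-! ### Partial spreads over a prime field -/

section Field

variable {p : ℕ} [Fact p.Prime]

/-- Multiplication in the field with `p ^ w` elements gives `p ^ w` linear maps all of whose
differences are injective. -/
theorem exists_family_injective_sub {m w : ℕ} (hw : w ≠ 0) (hmw : m ≤ w) :
    ∃ D : (Fin w → ZMod p) → ((Fin m → ZMod p) →ₗ[ZMod p] (Fin w → ZMod p)),
      ∀ a b, a ≠ b → ∀ x, D a x = D b x → x = 0 := by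
  have hfin : Module.finrank (ZMod p) (Fin w → ZMod p)
      = Module.finrank (ZMod p) (GaloisField p w) := by
    rw [GaloisField.finrank p hw, Module.finrank_fin_fun]
  let e : (Fin w → ZMod p) ≃ₗ[ZMod p] GaloisField p w := LinearEquiv.ofFinrankEq _ _ hfin
  let ι : (Fin m → ZMod p) →ₗ[ZMod p] (Fin w → ZMod p) :=
    Function.ExtendByZero.linearMap (ZMod p) (Fin.castLE hmw)
  have hι : Function.Injective ι := by
    intro x y hxy
    funext i
    have := congrFun hxy (Fin.castLE hmw i)
    simpa [ι, Function.ExtendByZero.linearMap_apply,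
      (Fin.castLE_injective hmw).extend_apply] using this
  refine ⟨fun a => e.symm.toLinearMap ∘ₗ LinearMap.mulLeft (ZMod p) (e a) ∘ₗ
    e.toLinearMap ∘ₗ ι, fun a b hab x hx => ?_⟩
  have h1 : e a * e (ι x) = e b * e (ι x) := by simpa using hx
  have h2 : e (ι x) = 0 := by
    by_contra h0
    exact hab (e.injective (mul_right_cancel₀ h0 h1))
  exact hι (by simpa using h2)

/-- A partial `m`-spread of a space of dimension `m * (k + 1) + l`. -/
theorem exists_partial_spread (m l : ℕ) (hm : 0 < m) (k : ℕ) :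
    ∃ (I : Type) (_ : Fintype I)
      (F : I → ((Fin m → ZMod p) →ₗ[ZMod p] (Fin (m * (k + 1) + l) → ZMod p))),
      Fintype.card I = 1 + ∑ j ∈ Finset.range k, p ^ (m * (j + 1) + l) ∧
      (∀ i, Function.Injective (F i)) ∧
      ∀ i j, i ≠ j → ∀ x y, F i x = F j y → x = 0 := by
  induction k with
  | zero =>
    have hml : m ≤ m * (0 + 1) + l := by simp
    refine ⟨Unit, inferInstance, fun _ =>
      Function.ExtendByZero.linearMap (ZMod p) (Fin.castLE hml), by simp, fun _ x y hxy => ?_,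
      fun i j hij => absurd (Subsingleton.elim i j) hij⟩
    funext i
    have := congrFun hxy (Fin.castLE hml i)
    simpa [Function.ExtendByZero.linearMap_apply,
      (Fin.castLE_injective hml).extend_apply] using this
  | succ k ih =>
    set w := m * (k + 1) + l with hw
    obtain ⟨I, _, F, hcard, hF, hdisj⟩ := ih
    have hmw : m ≤ w := by rw [hw]; nlinarith [Nat.zero_le (m * k)]
    obtain ⟨D, hD⟩ := exists_family_injective_sub (p := p) (m := m) (w := w) (by omega) hmw
    have hfin : Module.finrank (ZMod p) ((Fin m → ZMod p) × (Fin w → ZMod p))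
        = Module.finrank (ZMod p) (Fin (m * (k + 1 + 1) + l) → ZMod p) := by
      rw [Module.finrank_prod]
      simp only [Module.finrank_fin_fun]
      rw [hw]; ring
    let e := LinearEquiv.ofFinrankEq _ _ hfin
    -- The graphs of the maps `D a` meet each other and `0 × (Fin w → ZMod p)` trivially, so the
    -- previous spread survives inside the second factor.
    let F' : (Fin w → ZMod p) ⊕ I →
        ((Fin m → ZMod p) →ₗ[ZMod p] ((Fin m → ZMod p) × (Fin w → ZMod p))) :=
      Sum.elim (fun a => LinearMap.prod LinearMap.id (D a)) (fun i => LinearMap.prod 0 (F i))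
    have hinj : ∀ i x, F' i x = 0 → x = 0 := by
      rintro (a | i) x hx
      · exact (Prod.ext_iff.1 hx).1
      · exact hF i (by simpa [F'] using hx)
    refine ⟨(Fin w → ZMod p) ⊕ I, inferInstance, fun i => e.toLinearMap ∘ₗ F' i, ?_,
      fun i => ?_, ?_⟩
    · rw [Fintype.card_sum, hcard, Finset.sum_range_succ]
      simp [ZMod.card, hw]; ring
    · refine (injective_iff_map_eq_zero _).2 fun x hx => hinj i x (by simpa using hx)
    · intro i j hij x y hxy
      have hxy : F' i x = F' j y := e.injective hxy
      rcases i with a | i <;> rcases j with b | j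
      · simp only [F', Sum.elim_inl, LinearMap.prod_apply, Function.prod_apply, LinearMap.id_apply,
          Prod.mk.injEq] at hxy
        obtain ⟨rfl, h2⟩ := hxy
        exact hD a b (fun h => hij (by rw [h])) x h2
      · simpa [F'] using (Prod.ext_iff.1 hxy).1
      · have hy : 0 = y := (Prod.ext_iff.1 hxy).1
        refine hinj (Sum.inr i) x ?_
        rw [hxy, ← hy, map_zero]
      · exact hdisj i j (fun h => hij (by rw [h])) x y (Prod.ext_iff.1 hxy).2

/-- The linear perturbations of an injective map `F` along a complement of its range. -/
theorem exists_family_complement {m n : ℕ} (hm : 0 < m) (hmn : 2 * m ≤ n)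
    (F : (Fin m → ZMod p) →ₗ[ZMod p] (Fin n → ZMod p)) (hF : Function.Injective F) :
    ∃ D : (Fin (n - m) → ZMod p) → ((Fin m → ZMod p) →ₗ[ZMod p] (Fin n → ZMod p)),
      ∀ a b, a ≠ b → ∀ x z, F z + (D a x - D b x) = 0 → x = 0 := by
  obtain ⟨D, hD⟩ := exists_family_injective_sub (p := p) (m := m) (w := n - m) (by omega)
    (by omega)
  obtain ⟨W, hW⟩ := Submodule.exists_isCompl (LinearMap.range F)
  have hfin : Module.finrank (ZMod p) (Fin (n - m) → ZMod p) = Module.finrank (ZMod p) W := by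
    have h1 := Submodule.finrank_add_eq_of_isCompl hW
    rw [LinearMap.finrank_range_of_inj hF] at h1
    simp only [Module.finrank_fin_fun] at h1 ⊢
    omega
  let e := LinearEquiv.ofFinrankEq _ _ hfin
  refine ⟨fun a => W.subtype ∘ₗ e.toLinearMap ∘ₗ D a, fun a b hab x z h => ?_⟩
  have h1 : ((e (D a x - D b x) : W) : Fin n → ZMod p) = F (-z) := by
    rw [map_neg, eq_neg_iff_add_eq_zero, add_comm]
    simpa using h
  -- The vector lies both in `W` and in the range of `F`.
  have h2 : ((e (D a x - D b x) : W) : Fin n → ZMod p) = 0 :=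
    Submodule.disjoint_def.1 hW.disjoint _ (h1 ▸ LinearMap.mem_range_self F _) (e _).2
  have h3 : D a x - D b x = 0 := e.map_eq_zero_iff.1 (Subtype.ext h2)
  exact hD a b hab x (sub_eq_zero.1 h3)

end Field

/-! ### Reduction of integer vectors -/

/-- Entrywise reduction of an integer vector modulo `q`. -/
def red (q : ℕ) {n : ℕ} (x : Fin n → ℤ) : Fin n → ZMod q := fun i => (x i : ZMod q)

section Reduction

variable {q m n : ℕ}

theorem red_add (x y : Fin n → ℤ) : red q (x + y) = red q x + red q y := by
  ext i; simp [red]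

theorem red_sub (x y : Fin n → ℤ) : red q (x - y) = red q x - red q y := by
  ext i; simp [red]

theorem red_vecMul (x : Fin m → ℤ) (G : Matrix (Fin m) (Fin n) ℤ) :
    red q (x ᵥ* G) = red q x ᵥ* G.map (Int.cast : ℤ → ZMod q) := by
  ext i
  exact RingHom.map_vecMul (Int.castRingHom (ZMod q)) G x i

theorem red_dotProduct (x y : Fin n → ℤ) : red q x ⬝ᵥ red q y = ((x ⬝ᵥ y : ℤ) : ZMod q) :=
  (RingHom.map_dotProduct (Int.castRingHom (ZMod q)) x y).symm

theorem red_surjective : Function.Surjective (red q (n := n)) := fun x => by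
  choose y hy using fun i => ZMod.intCast_surjective (x i)
  exact ⟨y, funext hy⟩

theorem red_eq_zero_iff (x : Fin n → ℤ) : red q x = 0 ↔ ∃ z, x = (q : ℤ) • z := by
  constructor
  · intro h
    choose z hz using fun i => (ZMod.intCast_zmod_eq_zero_iff_dvd (x i) q).1 (congrFun h i)
    exact ⟨z, funext hz⟩
  · rintro ⟨z, rfl⟩
    ext i
    simp [red]

theorem red_eq_zero_of_dvd {q' : ℕ} (h : q' ∣ q) {x : Fin n → ℤ} (hx : red q x = 0) :
    red q' x = 0 := by
  obtain ⟨c, rfl⟩ := h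
  obtain ⟨z, rfl⟩ := (red_eq_zero_iff x).1 hx
  refine (red_eq_zero_iff _).2 ⟨(c : ℤ) • z, ?_⟩
  rw [smul_smul]; push_cast; rfl

theorem red_smul_mul_eq_zero_iff {a b : ℕ} (ha : a ≠ 0) (x : Fin n → ℤ) :
    red (a * b) ((a : ℤ) • x) = 0 ↔ red b x = 0 := by
  rw [red_eq_zero_iff, red_eq_zero_iff]
  have ha' : (a : ℤ) ≠ 0 := by exact_mod_cast ha
  refine exists_congr fun z => ?_
  rw [Nat.cast_mul, mul_smul]
  exact (smul_right_injective _ ha').eq_iff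

theorem exists_matrix_lift (F : (Fin m → ZMod q) →ₗ[ZMod q] (Fin n → ZMod q)) :
    ∃ G : Matrix (Fin m) (Fin n) ℤ, ∀ x, red q (x ᵥ* G) = F (red q x) := by
  choose G hG using fun i => red_surjective (LinearMap.toMatrixRight' F i)
  refine ⟨Matrix.of G, fun x => ?_⟩
  have : (Matrix.of G).map (Int.cast : ℤ → ZMod q) = LinearMap.toMatrixRight' F := by
    ext i j
    exact congrFun (hG i) j
  rw [red_vecMul, this, ← Matrix.toLinearMapRight'_apply]
  simp

end Reduction

/-! ### Lifting along powers of a prime -/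

/-- A family of integer `m × n` matrices of full rank modulo `p`, whose row spaces modulo `q`
pairwise meet in combinations with coefficients divisible by `p`. -/
structure IsSeparated (p q : ℕ) {m n : ℕ} {I : Type*} (G : I → Matrix (Fin m) (Fin n) ℤ) :
    Prop where
  injective : ∀ i x, red p (x ᵥ* G i) = 0 → red p x = 0
  separated : ∀ i j, i ≠ j → ∀ x y, red q (x ᵥ* G i) = red q (y ᵥ* G j) → red p x = 0

theorem exists_eq_smul_of_red_vecMul_eq_zero {p m n : ℕ} (hp : p ≠ 0)
    {G : Matrix (Fin m) (Fin n) ℤ} (hG : ∀ x, red p (x ᵥ* G) = 0 → red p x = 0) (s : ℕ)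
    (x : Fin m → ℤ) (hx : red (p ^ s) (x ᵥ* G) = 0) : ∃ z, x = ((p ^ s : ℕ) : ℤ) • z := by
  induction s with
  | zero => exact ⟨x, by simp⟩
  | succ s ih =>
    obtain ⟨z, rfl⟩ := ih (red_eq_zero_of_dvd (pow_dvd_pow p s.le_succ) hx)
    rw [smul_vecMul, pow_succ, red_smul_mul_eq_zero_iff (pow_ne_zero _ hp)] at hx
    obtain ⟨y, rfl⟩ := (red_eq_zero_iff z).1 (hG z hx)
    exact ⟨y, by rw [smul_smul, pow_succ]; push_cast; rfl⟩

/-- Each `G i` is perturbed by `p ^ s` times lifts of maps into a complement of its row space modulo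
`p`. Distinct `i` are already separated modulo `p ^ s`; for equal `i`, the next `p`-adic digit
separates the perturbations. -/
theorem IsSeparated.exists_lift {p m n s : ℕ} [Fact p.Prime] (hs : s ≠ 0) (hm : 0 < m)
    (hmn : 2 * m ≤ n) {I : Type} {G : I → Matrix (Fin m) (Fin n) ℤ}
    (hG : IsSeparated p (p ^ s) G) :
    ∃ G' : I × (Fin (n - m) → ZMod p) → Matrix (Fin m) (Fin n) ℤ,
      IsSeparated p (p ^ (s + 1)) G' := by
  have hp : p ≠ 0 := (Fact.out : p.Prime).ne_zero
  have hF : ∀ i, Function.Injective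
      (Matrix.vecMulLinear ((G i).map (Int.cast : ℤ → ZMod p))) := fun i =>
    (injective_iff_map_eq_zero _).2 fun x hx => by
      obtain ⟨x, rfl⟩ := red_surjective x
      rw [Matrix.vecMulLinear_apply, ← red_vecMul] at hx
      exact hG.injective i x hx
  choose D hD using fun i => exists_family_complement hm hmn _ (hF i)
  choose E hE using fun i a => exists_matrix_lift (D i a)
  have hvec : ∀ i a (x : Fin m → ℤ), x ᵥ* (G i + ((p ^ s : ℕ) : ℤ) • E i a)
      = x ᵥ* G i + ((p ^ s : ℕ) : ℤ) • (x ᵥ* E i a) := fun i a x => by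
    rw [vecMul_add, vecMul_smul]
  have hred : ∀ i a (x : Fin m → ℤ), red (p ^ s) (x ᵥ* (G i + ((p ^ s : ℕ) : ℤ) • E i a))
      = red (p ^ s) (x ᵥ* G i) := fun i a x => by
    rw [hvec, red_add, (red_eq_zero_iff (_ • _)).2 ⟨_, rfl⟩, add_zero]
  refine ⟨fun ia => G ia.1 + ((p ^ s : ℕ) : ℤ) • E ia.1 ia.2, ⟨fun ⟨i, a⟩ x hx => ?_, ?_⟩⟩
  · refine hG.injective i x ?_
    rw [hvec, red_add, red_eq_zero_of_dvd (q := p ^ s) (dvd_pow_self p hs)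
      ((red_eq_zero_iff (_ • _)).2 ⟨_, rfl⟩), add_zero] at hx
    exact hx
  · rintro ⟨i, a⟩ ⟨j, b⟩ hij x y hxy
    rw [← sub_eq_zero, ← red_sub] at hxy
    have hlow := red_eq_zero_of_dvd (pow_dvd_pow p s.le_succ) hxy
    rw [red_sub, hred, hred, sub_eq_zero] at hlow
    by_cases h : i = j
    · subst h
      have hab : a ≠ b := fun h => hij (by rw [h])
      rw [← sub_eq_zero, ← red_sub, ← sub_vecMul] at hlow
      obtain ⟨z, hz⟩ := exists_eq_smul_of_red_vecMul_eq_zero hp (hG.injective i) s _ hlow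
      have hdiff : x ᵥ* (G i + ((p ^ s : ℕ) : ℤ) • E i a)
          - y ᵥ* (G i + ((p ^ s : ℕ) : ℤ) • E i b)
          = ((p ^ s : ℕ) : ℤ) • (z ᵥ* G i + (x ᵥ* E i a - y ᵥ* E i b)) := by
        have hzG : ((p ^ s : ℕ) : ℤ) • (z ᵥ* G i) = x ᵥ* G i - y ᵥ* G i := by
          rw [← smul_vecMul, ← hz, sub_vecMul]
        rw [hvec, hvec, smul_add, hzG, smul_sub]
        abel
      -- As `s ≥ 1`, both coefficient vectors agree modulo `p`, so dividing by `p ^ s` leaves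
      -- exactly the relation excluded by `hD`.
      have hxy' : red p x = red p y := by
        rw [← sub_eq_zero, ← red_sub, hz]
        exact red_eq_zero_of_dvd (q := p ^ s) (dvd_pow_self p hs)
          ((red_eq_zero_iff (_ • _)).2 ⟨_, rfl⟩)
      simp only at hxy
      rw [hdiff, pow_succ, red_smul_mul_eq_zero_iff (pow_ne_zero _ hp), red_add, red_sub, hE, hE,
        red_vecMul, ← hxy'] at hxy
      exact hD i a b hab _ _ hxy
    · exact hG.separated i j h x y hlow

theorem exists_isSeparated {p m l k s : ℕ} (hp : p.Prime) (hm : 0 < m)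
    -- Here `s` is the exponent minus one; `s = 0` is the squarefree case, where no lifting is
    -- needed.
    (hks : 2 * m ≤ m * (k + 1) + l ∨ s = 0) :
    ∃ (I : Type) (_ : Fintype I) (G : I → Matrix (Fin m) (Fin (m * (k + 1) + l)) ℤ),
      Fintype.card I = p ^ (s * (m * (k + 1) + l - m)) *
        (1 + ∑ j ∈ Finset.range k, p ^ (m * (j + 1) + l)) ∧
      IsSeparated p (p ^ (s + 1)) G := by
  have : Fact p.Prime := ⟨hp⟩
  induction s with
  | zero =>
    obtain ⟨I, hI, F, hcard, hF, hdisj⟩ := exists_partial_spread (p := p) m l hm k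
    choose G hG using fun i => exists_matrix_lift (F i)
    refine ⟨I, hI, G, by simpa using hcard, fun i x hx => ?_, fun i j hij x y hxy => ?_⟩
    · rw [hG] at hx
      exact hF i (by rw [hx, map_zero])
    · rw [zero_add, pow_one, hG, hG] at hxy
      exact hdisj i j hij _ _ hxy
  | succ s ih =>
    have hn := hks.resolve_right (Nat.succ_ne_zero s)
    obtain ⟨I, hI, G, hcard, hG⟩ := ih (Or.inl hn)
    obtain ⟨G', hG'⟩ := hG.exists_lift s.succ_ne_zero hm hn
    refine ⟨_, inferInstance, G', ?_, hG'⟩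
    rw [Fintype.card_prod, hcard, Fintype.card_fun, ZMod.card, Fintype.card_fin]
    ring

/-! ### Gluing over the primes -/

theorem dim_eq_zero {R : Type*} [CommRing R] {n : ℕ} {V : Submodule R (Fin n → R)}
    (hV : ∀ v ∈ V, ∀ b, v ⬝ᵥ b ≠ 1) : dim V = 0 := by
  refine Nat.le_zero.1 (csSup_le' ?_)
  rintro k ⟨v, hv, B, hB⟩
  by_contra hk
  have hk : 0 < k := by omega
  refine hV (v ⟨0, hk⟩) (hv _) (fun i => B i ⟨0, hk⟩) ?_
  have := congrFun (congrFun hB ⟨0, hk⟩) ⟨0, hk⟩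
  rwa [one_apply_eq] at this

theorem exists_int_congruent {ι : Type*} [Finite ι] {q : ι → ℕ}
    (hq : Pairwise fun i j => (q i).Coprime (q j)) (x : ι → ℤ) :
    ∃ r : ℤ, ∀ i, (r : ZMod (q i)) = (x i : ZMod (q i)) := by
  obtain ⟨r, hr⟩ := Ideal.exists_forall_sub_mem_ideal (I := fun i => Ideal.span {(q i : ℤ)})
    (fun i j hij => (Ideal.isCoprime_span_singleton_iff _ _).2
      (Nat.isCoprime_iff_coprime.2 (hq hij))) x
  refine ⟨r, fun i => ?_⟩
  rw [← sub_eq_zero, ← Int.cast_sub, ZMod.intCast_zmod_eq_zero_iff_dvd]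
  exact Ideal.mem_span_singleton.1 (hr i)

theorem exists_matrix_congruent {ι : Type*} [Finite ι] {q : ι → ℕ}
    (hq : Pairwise fun i j => (q i).Coprime (q j)) {a b : Type*} (M : ι → Matrix a b ℤ) :
    ∃ N : Matrix a b ℤ, ∀ i, N.map (Int.cast : ℤ → ZMod (q i)) = (M i).map Int.cast := by
  choose N hN using fun r c => exists_int_congruent hq fun i => M i r c
  exact ⟨Matrix.of N, fun i => by ext r c; exact hN r c i⟩

theorem exists_rightInverse_mod {p m n : ℕ} [Fact p.Prime] {G : Matrix (Fin m) (Fin n) ℤ}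
    (hG : ∀ x, red p (x ᵥ* G) = 0 → red p x = 0) :
    ∃ B : Matrix (Fin n) (Fin m) ℤ, (G * B).map (Int.cast : ℤ → ZMod p) = 1 := by
  have hker : LinearMap.ker (G.map (Int.cast : ℤ → ZMod p)).vecMulLinear = ⊥ := by
    refine LinearMap.ker_eq_bot'.2 fun x hx => ?_
    obtain ⟨x, rfl⟩ := red_surjective x
    rw [Matrix.vecMulLinear_apply, ← red_vecMul] at hx
    exact hG x hx
  obtain ⟨g, hg⟩ := LinearMap.exists_leftInverse_of_injective _ hker
  obtain ⟨B, hB⟩ := exists_matrix_lift g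
  refine ⟨B, ?_⟩
  have hGB : ∀ x, x ᵥ* (G * B).map (Int.cast : ℤ → ZMod p) = x := fun x => by
    obtain ⟨x, rfl⟩ := red_surjective x
    rw [← red_vecMul, ← vecMul_vecMul, hB, red_vecMul]
    exact LinearMap.congr_fun hg (red p x)
  ext i j
  have := congrFun (hGB (Pi.single i 1)) j
  rw [single_one_vecMul] at this
  rw [one_eq_pi_single]
  exact this

/-- Right inverses need gluing only modulo the primes: the determinant of `G * N` is then prime to
the modulus, so `G * N` is invertible there. -/
theorem unimodular_of_mod_primes {ι : Type*} [Fintype ι] {p s : ι → ℕ} (hp : ∀ i, (p i).Prime)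
    (hpinj : Function.Injective p) {m n : ℕ} {G : Matrix (Fin m) (Fin n) ℤ}
    (hG : ∀ i x, red (p i) (x ᵥ* G) = 0 → red (p i) x = 0) :
    IsUnimodular (G.map (Int.cast : ℤ → ZMod (∏ i, p i ^ s i))) := by
  have : ∀ i, Fact (p i).Prime := fun i => ⟨hp i⟩
  choose B hB using fun i => exists_rightInverse_mod (hG i)
  obtain ⟨N, hN⟩ := exists_matrix_congruent (q := p)
    (fun i j hij => (Nat.coprime_primes (hp i) (hp j)).2 fun h => hij (hpinj h)) B
  have hmod : ∀ i, ((G * N).det : ZMod (p i)) = 1 := fun i => by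
    have h1 : (G * N).map (Int.cast : ℤ → ZMod (p i)) = 1 := by
      rw [← hB i]
      have := hN i
      change (G * N).map (Int.castRingHom (ZMod (p i))) = (G * B i).map (Int.castRingHom _)
      rw [Matrix.map_mul, Matrix.map_mul]
      exact congrArg _ this
    have h2 := RingHom.map_det (Int.castRingHom (ZMod (p i))) (G * N)
    rw [eq_intCast] at h2
    rw [h2]
    exact (congrArg det h1).trans det_one
  have hcop : IsCoprime (G * N).det ((∏ i, p i ^ s i : ℕ) : ℤ) := by
    push_cast
    refine IsCoprime.prod_right fun i _ => IsCoprime.pow_right ?_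
    obtain ⟨c, hc⟩ := (ZMod.intCast_eq_intCast_iff_dvd_sub 1 (G * N).det (p i)).1
      (by rw [hmod i, Int.cast_one])
    exact ⟨1, -c, by linarith⟩
  set h := ∏ i, p i ^ s i with hh
  have hunit : IsUnit ((G * N).map (Int.castRingHom (ZMod h))).det := by
    have h2 := RingHom.map_det (Int.castRingHom (ZMod h)) (G * N)
    rw [RingHom.mapMatrix_apply] at h2
    rw [← h2]
    obtain ⟨a, b, hab⟩ := hcop
    refine IsUnit.of_mul_eq_one (a : ZMod h) ?_
    have := congrArg (Int.cast : ℤ → ZMod h) hab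
    rw [Int.cast_add, Int.cast_mul, Int.cast_mul, Int.cast_natCast, ZMod.natCast_self, mul_zero,
      add_zero, Int.cast_one] at this
    rw [eq_intCast, mul_comm]
    exact this
  refine ⟨N.map (Int.castRingHom (ZMod h)) * ((G * N).map (Int.castRingHom (ZMod h)))⁻¹, ?_⟩
  rw [← Matrix.mul_assoc]
  refine Eq.trans ?_ (Matrix.mul_nonsing_inv _ hunit)
  rw [Matrix.map_mul (f := Int.castRingHom (ZMod h))]
  rfl

theorem card_le_indepNum {ι : Type*} [Fintype ι] {p s : ι → ℕ} (hp : ∀ i, (p i).Prime)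
    (hpinj : Function.Injective p) (hs : ∀ i, s i ≠ 0) {m n : ℕ} (hm : 0 < m)
    {I : ι → Type} [∀ i, Fintype (I i)] {G : ∀ i, I i → Matrix (Fin m) (Fin n) ℤ}
    (hG : ∀ i, IsSeparated (p i) (p i ^ s i) (G i)) :
    ∏ i, Fintype.card (I i) ≤ (grassmannGraph m m n (ZMod (∏ i, p i ^ s i))).indepNum := by
  classical
  set h := ∏ i, p i ^ s i with hh
  have : NeZero h := ⟨Finset.prod_ne_zero_iff.2 fun i _ => pow_ne_zero _ (hp i).ne_zero⟩
  have hcop : Pairwise fun i j => (p i ^ s i).Coprime (p j ^ s j) := fun i j hij =>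
    Nat.Coprime.pow _ _ ((Nat.coprime_primes (hp i) (hp j)).2 fun e => hij (hpinj e))
  choose N hN using fun f : ∀ i, I i => exists_matrix_congruent hcop fun i => G i (f i)
  have hred : ∀ f i x, red (p i ^ s i) (x ᵥ* N f) = red (p i ^ s i) (x ᵥ* G i (f i)) :=
    fun f i x => by rw [red_vecMul, hN, red_vecMul]
  have hinj : ∀ f i x, red (p i) (x ᵥ* N f) = 0 → red (p i) x = 0 := fun f i x hx => by
    refine (hG i).injective (f i) x ?_
    have h0 : red (p i) (x ᵥ* N f - x ᵥ* G i (f i)) = 0 :=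
      red_eq_zero_of_dvd (dvd_pow_self (p i) (hs i))
        (by rw [red_sub, hred, sub_self])
    rwa [red_sub, hx, zero_sub, neg_eq_zero] at h0
  have huni : ∀ f, IsUnimodular ((N f).map (Int.cast : ℤ → ZMod h)) := fun f =>
    unimodular_of_mod_primes hp hpinj (hinj f)
  let X : (∀ i, I i) → {X : Submodule (ZMod h) (Fin n → ZMod h) // IsSubspace m X} := fun f =>
    ⟨Submodule.span (ZMod h) (Set.range ((N f).map (Int.cast : ℤ → ZMod h))), _, huni f, rfl⟩
  have hmem : ∀ f v, v ∈ (X f).1 → ∃ x : Fin m → ℤ, v = red h (x ᵥ* N f) := fun f v hv => by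
    have hv' : v ∈ LinearMap.range ((N f).map (Int.cast : ℤ → ZMod h)).vecMulLinear := by
      rw [_root_.range_vecMulLinear]; exact hv
    obtain ⟨x, rfl⟩ := hv'
    obtain ⟨x, rfl⟩ := red_surjective x
    exact ⟨x, (red_vecMul _ _).symm⟩
  have hsep : ∀ f g, f ≠ g → ∀ v, v ∈ (X f).1 ⊓ (X g).1 → ∀ b, v ⬝ᵥ b ≠ 1 := by
    intro f g hfg v hv b hb
    obtain ⟨i, hi⟩ := Function.ne_iff.1 hfg
    obtain ⟨x, hx⟩ := hmem f v hv.1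
    obtain ⟨y, hy⟩ := hmem g v hv.2
    have hdvd : p i ^ s i ∣ h := Finset.dvd_prod_of_mem _ (Finset.mem_univ i)
    have hxy : red (p i ^ s i) (x ᵥ* G i (f i)) = red (p i ^ s i) (y ᵥ* G i (g i)) := by
      rw [← hred, ← hred, ← sub_eq_zero, ← red_sub]
      exact red_eq_zero_of_dvd hdvd (by rw [red_sub, ← hx, ← hy, sub_self])
    have hx0 : red (p i) (x ᵥ* N f) = 0 := by
      rw [red_vecMul, (hG i).separated _ _ hi x y hxy, zero_vecMul]
    obtain ⟨c, rfl⟩ := red_surjective b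
    rw [hx, red_dotProduct, ← Int.cast_one, eq_comm, ZMod.intCast_eq_intCast_iff_dvd_sub] at hb
    have hpd : ((p i : ℕ) : ℤ) ∣ (x ᵥ* N f) ⬝ᵥ c - 1 :=
      (Int.natCast_dvd_natCast.2 ((dvd_pow_self (p i) (hs i)).trans hdvd)).trans hb
    obtain ⟨w, hw⟩ := (red_eq_zero_iff _).1 hx0
    rw [hw, smul_dotProduct, smul_eq_mul] at hpd
    exact (Nat.prime_iff_prime_int.1 (hp i)).not_dvd_one
      ((dvd_sub_right (dvd_mul_right _ _)).1 hpd)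
  -- If two choices gave the same subspace, its first basis row would be a common unimodular vector.
  have hXinj : Function.Injective X := fun f g hfg => by
    by_contra hne
    obtain ⟨B, hB⟩ := huni f
    refine hsep f g hne ((N f).map (Int.cast : ℤ → ZMod h) ⟨0, hm⟩) ?_ (fun i => B i ⟨0, hm⟩) ?_
    · rw [← hfg, inf_idem]
      exact Submodule.subset_span ⟨_, rfl⟩
    · have := congrFun (congrFun hB ⟨0, hm⟩) ⟨0, hm⟩
      rwa [one_apply_eq] at this
  have hindep : (grassmannGraph m m n (ZMod h)).IsIndepSet
      (Finset.univ.map ⟨X, hXinj⟩ : Finset _) := by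
    intro A hA B hB hAB hadj
    simp only [Finset.coe_map, Finset.coe_univ, Set.image_univ, Set.mem_range,
      Function.Embedding.coeFn_mk] at hA hB
    obtain ⟨f, rfl⟩ := hA
    obtain ⟨g, rfl⟩ := hB
    have := hadj.2
    rw [dim_eq_zero (hsep f g fun e => hAB (by rw [e]))] at this
    omega
  have := hindep.card_le_indepNum
  rwa [Finset.card_map, Finset.card_univ, Fintype.card_pi] at this

theorem spread_size_eq {q m l k : ℕ} (hq : 1 < q) (hm : m ≠ 0) :
    ((q : ℚ) ^ (m * (k + 1) + l) - (q : ℚ) ^ m * ((q : ℚ) ^ l - 1) - 1) / ((q : ℚ) ^ m - 1)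
      = 1 + ∑ j ∈ Finset.range k, (q : ℚ) ^ (m * (j + 1) + l) := by
  have h0 : (q : ℚ) ^ m - 1 ≠ 0 :=
    (sub_pos.2 (one_lt_pow₀ (by exact_mod_cast hq) hm)).ne'
  rw [div_eq_iff h0]
  induction k with
  | zero => simp; ring
  | succ k ih => rw [Finset.sum_range_succ, ← add_assoc, add_mul, ← ih]; ring

end ResidueGrassmann

theorem theorem5p8 (t : ℕ) (ht : 0 < t) (p s : Fin t → ℕ)
    (hp : ∀ i, (p i).Prime) (hpinj : Function.Injective p) (hs : ∀ i, 1 ≤ s i)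
    (h : ℕ) (hh : h = ∏ i, p i ^ s i)
    (m n l : ℕ) (hm : 2 ≤ m) (hmn : m < n) (hl : l < m) (hnl : n ≡ l [MOD m])
    (hns : 2 * m ≤ n ∨ ∀ i, s i = 1) :
    ∏ i, (((p i : ℚ) ^ ((s i - 1) * (n - m))) *
        (((p i : ℚ) ^ n - (p i : ℚ) ^ m * ((p i : ℚ) ^ l - 1) - 1) / ((p i : ℚ) ^ m - 1)))
      ≤ ((ResidueGrassmann.grassmannGraph m m n (ZMod h)).indepNum : ℚ) := by
  obtain ⟨k, rfl⟩ : ∃ k, n = m * (k + 1) + l := by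
    have h1 : n % m = l := by rw [hnl, Nat.mod_eq_of_lt hl]
    have h2 : 0 < n / m := Nat.div_pos hmn.le (by omega)
    refine ⟨n / m - 1, ?_⟩
    rw [Nat.sub_add_cancel h2, ← h1, Nat.div_add_mod]
  choose I hI G hcard hG using fun i => ResidueGrassmann.exists_isSeparated (k := k) (l := l)
    (s := s i - 1) (hp i) (by omega : 0 < m) (hns.imp_right fun h => by rw [h i])
  have hle := ResidueGrassmann.card_le_indepNum (s := s) hp hpinj
    (fun i => Nat.one_le_iff_ne_zero.1 (hs i)) (by omega : 0 < m)
    (fun i => by have := hG i; rwa [Nat.sub_add_cancel (hs i)] at this)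
  rw [← hh] at hle
  refine le_trans (le_of_eq ?_) (Nat.cast_le.2 hle)
  rw [Nat.cast_prod]
  refine Finset.prod_congr rfl fun i _ => ?_
  rw [hcard, ResidueGrassmann.spread_size_eq (hp i).one_lt (by omega)]
  push_cast
  rfl
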